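/- For a partition $\lambda$ (possibly empty) let $\ell(\lambda)$ be its number of parts and $\sigma(\lambda)$ the sum of its parts. For an integer $t\ge 1$, let $\mathcal V_t$ be the set of vectors $\vec\lambda=(\lambda_1,\lambda_2,\lambda_3,\lambda_4,\lambda_5,t\lambda_6,t\lambda_7)$, where $\lambda_1$ is a partition into distinct even parts, $\lambda_2,\lambda_3,\lambda_4,\lambda_5$ are partitions into odd parts, $\lambda_6,\lambda_7$ are arbitrary partitions, and $t\lambda$ denotes $\lambda$ with every part multiplied by $t$. Put $$s(\vec\lambda)=\sigma(\lambda_1)+\sigma(\lambda_2)+\sigma(\lambda_3)+\sigma(\lambda_4)+\sigma(\lambda_5)+t\sigma(\lambda_6)+t\sigma(\lambda_7),$$ $$r_7(\vec\lambda)=\ell(\lambda_2)-\ell(\lambda_3)+2\bigl(\ell(\lambda_4)-\ell(\lambda_5)\bigr)+2\bigl(\ell(\lambda_6)-\ell(\lambda_7)\bigr),$$ and let $$N_{\mathcal V_t}(i,m,n)=\sum_{\substack{\vec\lambda\in\mathcal V_t,\ s(\vec\lambda)=n\\ r_7(\vec\lambda)\equiv i \pmod m}}(-1)^{\ell(\lambda_1)}.$$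 Let $w_t(n)$ be defined by $$\sum_{n\ge 0}w_t(n)q^n=\frac{(q^2;q^2)_\infty}{(q;q^2)_\infty^4\,(q^t;q^t)_\infty^2},\qquad (a;q)_\infty=\prod_{k\ge 0}(1-aq^k).$$ Then for all integers $t\ge 1$ and $n\ge 0$: 1. if $t\equiv 1\pmod 5$, then $N_{\mathcal V_t}(0,5,5n+4)=N_{\mathcal V_t}(1,5,5n+4)=\cdots=N_{\mathcal V_t}(4,5,5n+4)=\dfrac{w_t(5n+4)}{5}$; 2. if $t\equiv 4\pmod 5$, then $N_{\mathcal V_t}(0,5,5n+3)=N_{\mathcal V_t}(1,5,5n+3)=\cdots=N_{\mathcal V_t}(4,5,5n+3)=\dfrac{w_t(5n+3)}{5}$; 3. if $t\equiv 0\pmod 5$, then $N_{\mathcal V_t}(0,5,5n+3)=N_{\mathcal V_t}(1,5,5n+3)=\cdots=N_{\mathcal V_t}(4,5,5n+3)=\dfrac{w_t(5n+3)}{5}$; 4. if $t\equiv 0\pmod 5$, then $N_{\mathcal V_t}(0,5,5n+4)=N_{\mathcal V_t}(1,5,5n+4)=\cdots=N_{\mathcal V_t}(4,5,5n+4)=\dfrac{w_t(5n+4)}{5}$.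 -/

import Mathlib

namespace WeightedPartition

open PowerSeries
open scoped PowerSeries.WithPiTopology

/-! The generating function of `w_t(n)`, as a formal power series in `q = X`. -/

/-- `(q^a; q^b)_∞ = ∏_{k ≥ 0} (1 - q^(a + b k))`, an infinite product of formal power series for
the topology of coefficientwise convergence (`ℤ` is discrete). -/
noncomputable def qPoch (a b : ℕ) : ℤ⟦X⟧ :=
  ∏' k : ℕ, ((1 : ℤ⟦X⟧) - X ^ (a + b * k))

/-- `(q;q²)_∞⁴ (q^t;q^t)_∞²`. -/
noncomputable def genFunDenominator (t : ℕ) : ℤ⟦X⟧ :=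
  qPoch 1 2 ^ 4 * qPoch t t ^ 2

/-- The number `w_t(n)`, that is, the coefficient of `q^n` in
`(q²;q²)_∞ / ((q;q²)_∞⁴ (q^t;q^t)_∞²)`. -/
noncomputable def w (t n : ℕ) : ℤ :=
  coeff n (qPoch 2 2 * invOfUnit (genFunDenominator t) 1)

/-! The defining products converge, and the quotient is a true quotient. -/

theorem multipliable_qPoch (a : ℕ) {b : ℕ} (hb : 0 < b) :
    Multipliable fun k : ℕ => (1 : ℤ⟦X⟧) - X ^ (a + b * k) := by
  simp_rw [sub_eq_add_neg]
  apply WithPiTopology.multipliable_one_add_of_tendsto_order_atTop_nhds_top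
  refine ENat.tendsto_nhds_top_iff_natCast_lt.mpr
    (fun n => Filter.eventually_atTop.mpr ⟨n + 1, fun m hm => ?_⟩)
  rw [order_neg, order_X_pow]
  norm_cast
  nlinarith

theorem constantCoeff_qPoch {a b : ℕ} (ha : 0 < a) (hb : 0 < b) :
    constantCoeff (qPoch a b) = 1 := by
  rw [qPoch, (multipliable_qPoch a hb).map_tprod _ (WithPiTopology.continuous_constantCoeff ℤ)]
  have h : ∀ k : ℕ, constantCoeff ((1 : ℤ⟦X⟧) - X ^ (a + b * k)) = 1 := by
    intro k
    have h0 : a + b * k ≠ 0 := by omega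
    rw [map_sub, map_one, map_pow, constantCoeff_X, zero_pow h0, sub_zero]
  simp [h]

theorem mk_w_mul_genFunDenominator {t : ℕ} (ht : 0 < t) :
    PowerSeries.mk (w t) * genFunDenominator t = qPoch 2 2 := by
  have h : PowerSeries.mk (w t) = qPoch 2 2 * invOfUnit (genFunDenominator t) 1 := by
    ext n
    simp [w]
  rw [h, mul_assoc, invOfUnit_mul, mul_one]
  simp [genFunDenominator, constantCoeff_qPoch, ht]

/-! Ordinary partitions. -/

/-- The set `𝒫` of all partitions (of all natural numbers). -/
abbrev Ptn : Type := Σ n : ℕ, Nat.Partition n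

namespace Ptn

/-- The parts of a partition, as a multiset of positive integers. -/
def parts (p : Ptn) : Multiset ℕ := p.2.parts

/-- `σ(λ)`, the sum of the parts. -/
def size (p : Ptn) : ℕ := p.parts.sum

/-- `ℓ(λ)`, the number of parts. -/
def length (p : Ptn) : ℕ := Multiset.card p.parts

/-- Membership in `𝒪`: all parts are odd. -/
def IsOdd (p : Ptn) : Prop := ∀ i ∈ p.parts, Odd i

/-- Membership in `𝒟ℰ`: the parts are even and pairwise distinct. -/
def IsDistinctEven (p : Ptn) : Prop := p.parts.Nodup ∧ ∀ i ∈ p.parts, Even i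

/-- The partition `tλ`, each part of `λ` being multiplied by `t ≥ 1`. -/
def dilate (t : ℕ) (ht : 0 < t) (p : Ptn) : Ptn :=
  ⟨t * p.1, p.2.parts.map (t * ·),
    by
      intro i hi
      obtain ⟨j, hj, rfl⟩ := Multiset.mem_map.mp hi
      exact Nat.mul_pos ht (p.2.parts_pos hj),
    by rw [Multiset.sum_map_mul_left, Multiset.map_id', p.2.parts_sum]⟩

theorem dilate_injective {t : ℕ} (ht : 0 < t) : Function.Injective (dilate t ht) := by
  rintro ⟨m, p⟩ ⟨n, q⟩ h
  have h1 : t * m = t * n := congrArg Sigma.fst h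
  obtain rfl : m = n := Nat.eq_of_mul_eq_mul_left ht h1
  have h2 : p.parts.map (t * ·) = q.parts.map (t * ·) := congrArg parts h
  have h3 : p.parts = q.parts :=
    Multiset.map_injective (fun a b hab => Nat.eq_of_mul_eq_mul_left ht hab) h2
  rw [Nat.Partition.ext h3]

end Ptn

/-! Vector partitions. -/

/-- The data `(λ₁, …, λ₇)` of a vector partition in `𝒱_t`: `λ₁` has distinct even parts,
`λ₂, λ₃, λ₄, λ₅` have odd parts, and `λ₆, λ₇` are arbitrary. The vector partition itself is
`(λ₁, λ₂, λ₃, λ₄, λ₅, tλ₆, tλ₇)`, see `toVector`; as `t ≥ 1`, it determines the `λᵢ`. -/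
@[ext]
structure VectorPartition where
  l₁ : Ptn
  l₂ : Ptn
  l₃ : Ptn
  l₄ : Ptn
  l₅ : Ptn
  l₆ : Ptn
  l₇ : Ptn
  distinctEven₁ : l₁.IsDistinctEven
  odd₂ : l₂.IsOdd
  odd₃ : l₃.IsOdd
  odd₄ : l₄.IsOdd
  odd₅ : l₅.IsOdd

namespace VectorPartition

/-- The vector `(λ₁, λ₂, λ₃, λ₄, λ₅, tλ₆, tλ₇)`; the set `𝒱_t` is the range of this map. -/
def toVector (t : ℕ) (ht : 0 < t) (v : VectorPartition) : Fin 7 → Ptn :=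
  ![v.l₁, v.l₂, v.l₃, v.l₄, v.l₅, v.l₆.dilate t ht, v.l₇.dilate t ht]

theorem toVector_injective {t : ℕ} (ht : 0 < t) : Function.Injective (toVector t ht) := by
  intro v v' h
  exact VectorPartition.ext (congrFun h 0) (congrFun h 1) (congrFun h 2) (congrFun h 3)
    (congrFun h 4) (Ptn.dilate_injective ht (congrFun h 5))
    (Ptn.dilate_injective ht (congrFun h 6))

/-- The sum of parts `s` of `(λ₁, λ₂, λ₃, λ₄, λ₅, tλ₆, tλ₇)`. -/
def s (t : ℕ) (v : VectorPartition) : ℕ :=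
  v.l₁.size + v.l₂.size + v.l₃.size + v.l₄.size + v.l₅.size + t * v.l₆.size + t * v.l₇.size

/-- The weight `(-1)^ℓ(λ₁)`. -/
def wt (v : VectorPartition) : ℤ := (-1) ^ v.l₁.length

/-- The multirank `r₇`. -/
def multirank (v : VectorPartition) : ℤ :=
  ((v.l₂.length : ℤ) - v.l₃.length) + 2 * ((v.l₄.length : ℤ) - v.l₅.length)
    + 2 * ((v.l₆.length : ℤ) - v.l₇.length)

end VectorPartition

open VectorPartition in
/-- `N_{𝒱_t}(k, m, n)`: the weighted count of the vector partitions of `n` in `𝒱_t` whose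
multirank is congruent to `k` modulo `m`. The index set is finite for `t ≥ 1`. -/
noncomputable def N (t : ℕ) (k : ℤ) (m n : ℕ) : ℤ :=
  ∑ᶠ v ∈ {v : VectorPartition | s t v = n ∧ multirank v ≡ k [ZMOD m]}, wt v

theorem Ptn.finite_size_le (n : ℕ) : {p : Ptn | p.size ≤ n}.Finite := by
  have h : {p : Ptn | p.size ≤ n} ⊆
      ⋃ k ∈ Finset.range (n + 1), Set.range (fun p : Nat.Partition k => (⟨k, p⟩ : Ptn)) := by
    rintro ⟨k, p⟩ hp
    have hk : p.parts.sum ≤ n := hp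
    rw [p.parts_sum] at hk
    simp only [Set.mem_iUnion]
    exact ⟨k, Finset.mem_range.mpr (by omega), p, rfl⟩
  exact (Set.Finite.biUnion (Finset.finite_toSet _) fun k _ => Set.finite_range _).subset h

theorem VectorPartition.finite_s_eq {t : ℕ} (ht : 0 < t) (n : ℕ) :
    {v : VectorPartition | v.s t = n}.Finite := by
  have hS := Ptn.finite_size_le n
  let f : VectorPartition → Ptn × Ptn × Ptn × Ptn × Ptn × Ptn × Ptn :=
    fun v => (v.l₁, v.l₂, v.l₃, v.l₄, v.l₅, v.l₆, v.l₇)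
  have hf : Function.Injective f := by
    intro v v' h
    simp only [f, Prod.mk.injEq] at h
    obtain ⟨h1, h2, h3, h4, h5, h6, h7⟩ := h
    exact VectorPartition.ext h1 h2 h3 h4 h5 h6 h7
  refine Set.Finite.subset (Set.Finite.preimage hf.injOn
    (hS.prod (hS.prod (hS.prod (hS.prod (hS.prod (hS.prod hS))))))) ?_
  intro v hv
  have h : v.l₁.size + v.l₂.size + v.l₃.size + v.l₄.size + v.l₅.size + t * v.l₆.size
    + t * v.l₇.size = n := hv
  have h6 : v.l₆.size ≤ t * v.l₆.size := Nat.le_mul_of_pos_left _ ht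
  have h7 : v.l₇.size ≤ t * v.l₇.size := Nat.le_mul_of_pos_left _ ht
  simp only [f, Set.mem_preimage, Set.mem_prod, Set.mem_ofPred_eq]
  refine ⟨?_, ?_, ?_, ?_, ?_, ?_, ?_⟩ <;> omega

end WeightedPartition

/-! Let `F(z)` be the sum of `(-1)^ℓ(λ₁) z^(r₇) q^s` over all vector partitions. It equals `(q²;q²)`
divided by the product of `(z^{±1} q;q²)`, `(z^{±2} q;q²)` and `(z^{±2} q^t;q^t)`. Let `z` be a
primitive fifth root of unity. Since the `1 - z^j x` for `j = 0, …, 4` multiply to `1 - x⁵`,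
supplying the missing factors gives `F(z) · (q⁵;q¹⁰)(q^{5t};q^{5t}) = (q;q) · (q^t;q^t)(z
q^t;q^t)(z⁻¹ q^t;q^t)` (`sizeGenFun_vectorPartition_mul_expand`). The series multiplying `F(z)`
involves only powers of `q⁵`, so a residue class mod 5 of exponents absent from the right side is
absent from `F(z)`.

By the pentagonal number theorem `(q;q)` has exponents 0, 1, 2 mod 5. By the Jacobi triple product,
`(q;q)(zq;q)(z⁻¹q;q)` is the sum of `(-1)^j q^{j(j+1)/2} χ_j` with `χ_j = z^{-j} + ⋯ + z^j`. As `χ_j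
= 0` for `j ≡ 2`, only exponents 0, 1 mod 5 survive (`coeff_zPoch_theta_eq_zero`). So the right side
lives in the classes `{0,1,2} + {0,t}`.

Where the coefficient of `F(z)` vanishes, `∑ N(i) zⁱ = 0`. The minimal polynomial of `z` over `ℚ`
has degree 4, so the five `N(i)` agree; setting `z = 1` shows that they add up to `w_t`. -/

namespace WeightedPartition

open PowerSeries
open scoped PowerSeries.WithPiTopology

/-! ### Finite form of the Jacobi triple product, and its reduction mod 5 -/

section FiniteTheta

variable {R : Type*} [CommRing R]

/-- The Gaussian binomial coefficient `[n, k]_q`, as a power series in `q = X`. -/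
noncomputable def gauss (R : Type*) [CommRing R] : ℕ → ℕ → R⟦X⟧
  | _, 0 => 1
  | 0, _ + 1 => 0
  | n + 1, k + 1 => gauss R n k + X ^ (k + 1) * gauss R n (k + 1)

@[simp] theorem gauss_zero_right (n : ℕ) : gauss R n 0 = 1 := by cases n <;> simp [gauss]

@[simp] theorem gauss_zero_succ (k : ℕ) : gauss R 0 (k + 1) = 0 := by simp [gauss]

theorem gauss_succ_succ (n k : ℕ) :
    gauss R (n + 1) (k + 1) = gauss R n k + X ^ (k + 1) * gauss R n (k + 1) := by
  rw [gauss]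

theorem gauss_eq_zero_of_lt {n k : ℕ} (h : n < k) : gauss R n k = 0 := by
  induction n generalizing k with
  | zero => obtain ⟨k, rfl⟩ := Nat.exists_eq_succ_of_ne_zero h.ne'; simp
  | succ n ih =>
    obtain ⟨k, rfl⟩ := Nat.exists_eq_succ_of_ne_zero (Nat.ne_zero_of_lt h)
    rw [Nat.succ_eq_add_one, gauss_succ_succ, ih (by omega), ih (by omega)]
    simp

theorem gauss_succ_succ' (n k : ℕ) :
    gauss R (n + 1) (k + 1) = X ^ (n - k) * gauss R n k + gauss R n (k + 1) := by
  induction n generalizing k with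
  | zero => rw [gauss_succ_succ]; simp
  | succ n ih =>
    rw [gauss_succ_succ (n + 1) k]
    have h1 := gauss_succ_succ (R := R) n k
    have h2 := ih k
    cases k with
    | zero =>
      simp only [gauss_zero_right, Nat.sub_zero] at *
      linear_combination X * h2 - h1
    | succ k =>
      have h0 := ih k
      have h3 := gauss_succ_succ (R := R) n k
      rw [Nat.add_sub_add_right]
      -- The exponent `n - k` is truncated; where truncation occurs the Gaussian binomial beside it
      -- is zero.
      rcases le_or_gt (k + 1) n with h | h
      · have h4 : n - k = n - (k + 1) + 1 := by omega
        rw [h4] at h0 ⊢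
        linear_combination h0 - X ^ (n - (k + 1) + 1) * h3 + X ^ (k + 2) * h2 - h1
      · rw [gauss_eq_zero_of_lt h] at *
        rw [gauss_eq_zero_of_lt (h.trans (Nat.lt_succ_self _))] at *
        linear_combination h0 - X ^ (n - k) * h3 + X ^ (k + 2) * h2 - h1

/-- The finite product `(q;q)_n`. -/
noncomputable def eulerProd (R : Type*) [CommRing R] (n : ℕ) : R⟦X⟧ :=
  ∏ i ∈ Finset.range n, (1 - X ^ (i + 1))

@[simp] theorem eulerProd_zero : eulerProd R 0 = 1 := by simp [eulerProd]

theorem eulerProd_succ (n : ℕ) : eulerProd R (n + 1) = eulerProd R n * (1 - X ^ (n + 1)) :=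
  Finset.prod_range_succ _ _

theorem isUnit_eulerProd (n : ℕ) : IsUnit (eulerProd R n) := by
  rw [PowerSeries.isUnit_iff_constantCoeff, eulerProd, map_prod]
  simp

/-- The factorial formula without division. The induction rests on `1 - q^(k+l+2) = (1 - q^(k+1)) +
q^(k+1) (1 - q^(l+1))`. -/
theorem gauss_add_mul (k l : ℕ) :
    gauss R (k + l) k * eulerProd R k * eulerProd R l = eulerProd R (k + l) := by
  induction h : k + l generalizing k l with
  | zero =>
    obtain ⟨rfl, rfl⟩ : k = 0 ∧ l = 0 := by omega
    simp
  | succ n ih =>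
    cases k with
    | zero =>
      obtain rfl : l = n + 1 := by omega
      simp
    | succ k =>
      have h1 := ih k l (by omega)
      cases l with
      | zero =>
        obtain rfl : k = n := by omega
        rw [gauss_succ_succ, gauss_eq_zero_of_lt (Nat.lt_succ_self k), eulerProd_succ]
        linear_combination (1 - X ^ (k + 1)) * h1
      | succ l =>
        have h2 := ih (k + 1) l (by omega)
        obtain rfl : n = k + l + 1 := by omega
        rw [gauss_succ_succ, eulerProd_succ (k + l + 1)]
        have e1 := eulerProd_succ (R := R) k
        have e2 := eulerProd_succ (R := R) l
        rw [e1] at h2 ⊢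
        rw [e2] at h1 ⊢
        linear_combination (1 - X ^ (k + 1)) * h1 + X ^ (k + 1) * (1 - X ^ (l + 1)) * h2

theorem gauss_symm (k l : ℕ) : gauss R (k + l) k = gauss R (k + l) l := by
  have h1 := gauss_add_mul (R := R) k l
  have h2 := gauss_add_mul (R := R) l k
  rw [add_comm l k] at h2
  refine ((isUnit_eulerProd (R := R) k).mul (isUnit_eulerProd l)).mul_right_cancel ?_
  linear_combination h1 - h2

theorem X_pow_dvd_eulerProd_sub {m n : ℕ} (h : m ≤ n) :
    (X : R⟦X⟧) ^ (m + 1) ∣ eulerProd R n - eulerProd R m := by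
  induction n, h using Nat.le_induction with
  | base => simp
  | succ n h ih =>
    have : eulerProd R (n + 1) - eulerProd R m =
        eulerProd R n - eulerProd R m - X ^ (n + 1) * eulerProd R n := by
      rw [eulerProd_succ]; ring
    rw [this]
    exact dvd_sub ih (Dvd.dvd.mul_right (pow_dvd_pow _ (by omega)) _)

/-- Quantifies how Gaussian binomials near the centre tend to `1/(q;q)_∞`: after clearing the unit
`(q;q)_{n+1+j}`, the error is made of two tails of Euler's product. -/
theorem X_pow_dvd_eulerProd_mul_gauss_sub_one {n j : ℕ} (h : j ≤ n) :
    (X : R⟦X⟧) ^ (n - j + 1) ∣ eulerProd R n * gauss R (2 * n + 1) (n + 1 + j) - 1 := by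
  have h1 := gauss_add_mul (R := R) (n + 1 + j) (n - j)
  rw [show n + 1 + j + (n - j) = 2 * n + 1 by omega] at h1
  have h2 : (X : R⟦X⟧) ^ (n - j + 1) ∣ eulerProd R n - eulerProd R (n - j) :=
    X_pow_dvd_eulerProd_sub (by omega)
  have h3 : (X : R⟦X⟧) ^ (n - j + 1) ∣ eulerProd R (2 * n + 1) - eulerProd R (n + 1 + j) :=
    (pow_dvd_pow _ (by omega)).trans (X_pow_dvd_eulerProd_sub (by omega))
  rw [← (isUnit_eulerProd (R := R) (n + 1 + j)).dvd_mul_left]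
  have : eulerProd R (n + 1 + j) * (eulerProd R n * gauss R (2 * n + 1) (n + 1 + j) - 1) =
      eulerProd R (n + 1 + j) * gauss R (2 * n + 1) (n + 1 + j) *
        (eulerProd R n - eulerProd R (n - j)) +
      (eulerProd R (2 * n + 1) - eulerProd R (n + 1 + j)) := by
    linear_combination h1
  rw [this]
  exact dvd_add (Dvd.dvd.mul_left h2 _) h3

/-- `χ_j = z^(-j) + ⋯ + z^j` as a polynomial in `a = z + z⁻¹`. -/
def thetaChar (a : R) : ℕ → R
  | 0 => 1
  | 1 => a + 1
  | j + 2 => a * thetaChar a (j + 1) - thetaChar a j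

/-- Comes from `a χ_0 = χ_1 - χ_0` and `a χ_j = χ_{j+1} + χ_{j-1}`. The last two terms are boundary
terms, absent once `c` vanishes from `M` on. -/
theorem mul_sum_thetaChar {A : Type*} [CommRing A] (a : A) (c : ℕ → A) (M : ℕ) :
    a * ∑ j ∈ Finset.range (M + 1), c j * thetaChar a j =
      (c 1 - c 0) * thetaChar a 0 +
      ∑ j ∈ Finset.range M, (c j + c (j + 2)) * thetaChar a (j + 1) +
      c M * thetaChar a (M + 1) - c (M + 1) * thetaChar a M := by
  induction M with
  | zero => simp [thetaChar]; ring
  | succ M ih =>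
    rw [Finset.sum_range_succ, mul_add, ih, Finset.sum_range_succ]
    have : thetaChar a (M + 1 + 1) = a * thetaChar a (M + 1) - thetaChar a M := by
      rw [thetaChar]
    rw [this]
    ring

/-- The coefficient of `χ_j` in `∏_{i=1}^n (1 - z q^i) (1 - z⁻¹ q^i)`. -/
noncomputable def thetaCoeff (R : Type*) [CommRing R] (n j : ℕ) : R⟦X⟧ :=
  (-1) ^ j * X ^ (j * (j + 1) / 2) * gauss R (2 * n + 1) (n + 1 + j)

theorem triangle_succ (j : ℕ) : (j + 1) * (j + 1 + 1) / 2 = j * (j + 1) / 2 + (j + 1) := by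
  rw [← Nat.add_mul_div_left _ _ (by simp)]
  ring_nf

theorem gauss_two_step (N k : ℕ) :
    gauss R (N + 2) (k + 2) = gauss R N (k + 1) + X ^ (N - k) * gauss R N k +
      X ^ (k + 2) * (X ^ (N - (k + 1)) * gauss R N (k + 1) + gauss R N (k + 2)) := by
  rw [gauss_succ_succ, gauss_succ_succ', gauss_succ_succ']
  ring

theorem gauss_two_step' (n j : ℕ) :
    gauss R (2 * n + 3) (n + 2 + j) = (1 + X ^ (2 * n + 2)) * gauss R (2 * n + 1) (n + 1 + j) +
      X ^ (n + 1 - j) * gauss R (2 * n + 1) (n + j) +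
      X ^ (n + 2 + j) * gauss R (2 * n + 1) (n + 2 + j) := by
  have h := gauss_two_step (R := R) (2 * n + 1) (n + j)
  rw [show n + j + 2 = n + 2 + j by ring, show n + j + 1 = n + 1 + j by ring,
    show 2 * n + 1 - (n + j) = n + 1 - j by omega] at h
  rw [h]
  rcases le_or_gt j n with hj | hj
  · have : (X : R⟦X⟧) ^ (2 * n + 2) = X ^ (n + 2 + j) * X ^ (2 * n + 1 - (n + 1 + j)) := by
      rw [← pow_add]; congr 1; omega
    rw [this]; ring
  · rw [gauss_eq_zero_of_lt (show 2 * n + 1 < n + 1 + j by omega)]; ring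

theorem thetaCoeff_succ_succ (n j : ℕ) :
    thetaCoeff R (n + 1) (j + 1) = (1 + X ^ (2 * n + 2)) * thetaCoeff R n (j + 1) -
      X ^ (n + 1) * (thetaCoeff R n j + thetaCoeff R n (j + 2)) := by
  have h := gauss_two_step' (R := R) n (j + 1)
  simp only [thetaCoeff, triangle_succ]
  rw [show 2 * (n + 1) + 1 = 2 * n + 3 by ring, show n + 1 + 1 + (j + 1) = n + 2 + (j + 1) by ring,
    h]
  rw [show n + 1 + (j + 2) = n + 2 + (j + 1) by ring, show n + (j + 1) = n + 1 + j by ring]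
  rcases le_or_gt j n with hj | hj
  · have : (X : R⟦X⟧) ^ (n + 1) = X ^ (j + 1) * X ^ (n + 1 - (j + 1)) := by
      rw [← pow_add]; congr 1; omega
    have h3 : (X : R⟦X⟧) ^ (n + 2 + (j + 1)) = X ^ (n + 1) * X ^ (j + 2) := by ring
    rw [h3, this]; ring
  · rw [gauss_eq_zero_of_lt (show 2 * n + 1 < n + 1 + j by omega)]; ring

/-- The general recurrence with the reflected value `c_{-1} = -c_0`, which is the symmetry `[2n+1,
n] = [2n+1, n+1]`. -/
theorem thetaCoeff_succ_zero (n : ℕ) :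
    thetaCoeff R (n + 1) 0 = (1 + X ^ (2 * n + 2)) * thetaCoeff R n 0 -
      X ^ (n + 1) * (thetaCoeff R n 1 - thetaCoeff R n 0) := by
  have h := gauss_two_step' (R := R) n 0
  have h1 := gauss_symm (R := R) n (n + 1)
  rw [show n + (n + 1) = 2 * n + 1 by ring] at h1
  simp only [thetaCoeff]
  simp only [add_zero, Nat.sub_zero] at h
  rw [h1] at h
  norm_num [show 2 * (n + 1) + 1 = 2 * n + 3 by ring, add_assoc] at h ⊢
  rw [h]
  ring

theorem thetaCoeff_eq_zero {n j : ℕ} (h : n < j) : thetaCoeff R n j = 0 := by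
  rw [thetaCoeff, gauss_eq_zero_of_lt (by omega), mul_zero]

/-- Finite Jacobi triple product. Times `1 - z` the left side has `2n + 1` linear factors in `z`, up
to powers of `z`, while `(1 - z) χ_j = z^{-j} - z^{j+1}`; hence the binomials `[2n+1, n+1+j]`.
Working in `a = z + z⁻¹` avoids Laurent series. -/
theorem prod_eq_sum_thetaCoeff (a : R⟦X⟧) (n M : ℕ) (h : n ≤ M) :
    ∏ i ∈ Finset.range n, (1 - a * X ^ (i + 1) + X ^ (2 * (i + 1))) =
      ∑ j ∈ Finset.range (M + 1), thetaCoeff R n j * thetaChar a j := by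
  induction n generalizing M with
  | zero =>
    rw [Finset.sum_range_succ', Finset.sum_eq_zero fun j _ => by
      rw [thetaCoeff_eq_zero (Nat.succ_pos j), zero_mul]]
    simp [thetaCoeff, thetaChar, gauss_succ_succ 0 0]
  | succ n ih =>
    rw [Finset.prod_range_succ, ih M (by omega)]
    have h1 := mul_sum_thetaChar a (thetaCoeff R n) M
    rw [thetaCoeff_eq_zero (show n < M by omega), thetaCoeff_eq_zero (show n < M + 1 by omega)]
      at h1
    have h2 : ∑ j ∈ Finset.range (M + 1), thetaCoeff R (n + 1) j * thetaChar a j =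
        (1 + X ^ (2 * n + 2)) * ∑ j ∈ Finset.range (M + 1), thetaCoeff R n j * thetaChar a j -
        X ^ (n + 1) * ((thetaCoeff R n 1 - thetaCoeff R n 0) * thetaChar a 0 +
          ∑ j ∈ Finset.range M,
            (thetaCoeff R n j + thetaCoeff R n (j + 2)) * thetaChar a (j + 1)) := by
      rw [Finset.sum_range_succ', Finset.sum_range_succ' _ M, thetaCoeff_succ_zero]
      simp only [thetaCoeff_succ_succ]
      simp only [mul_add, Finset.mul_sum, sub_mul, Finset.sum_sub_distrib, Finset.sum_add_distrib,
        add_mul]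
      ring_nf
    rw [h2]
    linear_combination (-X ^ (n + 1)) * h1

theorem coeff_eulerProd_mul_prod (a : R⟦X⟧) {m n : ℕ} (h : m ≤ n) :
    coeff m (eulerProd R n * ∏ i ∈ Finset.range n, (1 - a * X ^ (i + 1) + X ^ (2 * (i + 1)))) =
      coeff m (∑ j ∈ Finset.range (n + 1), (-1) ^ j * X ^ (j * (j + 1) / 2) * thetaChar a j) := by
  rw [← sub_eq_zero, ← map_sub, prod_eq_sum_thetaCoeff a n n le_rfl, Finset.mul_sum,
    ← Finset.sum_sub_distrib]
  refine (PowerSeries.X_pow_dvd_iff (n := n + 1)).mp (Finset.dvd_sum fun j hj => ?_) m (by omega)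
  have hj : j ≤ n := by simpa [Nat.lt_succ_iff] using hj
  have h1 := X_pow_dvd_eulerProd_mul_gauss_sub_one (R := R) hj
  have h2 : eulerProd R n * (thetaCoeff R n j * thetaChar a j) -
      (-1) ^ j * X ^ (j * (j + 1) / 2) * thetaChar a j =
      X ^ (j * (j + 1) / 2) * (eulerProd R n * gauss R (2 * n + 1) (n + 1 + j) - 1) *
        ((-1) ^ j * thetaChar a j) := by
    rw [thetaCoeff]; ring
  rw [h2]
  refine Dvd.dvd.mul_right (dvd_trans ?_ (mul_dvd_mul_left _ h1)) _
  rw [← pow_add]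
  refine pow_dvd_pow _ ?_
  -- The `j`-th error has order at least `j(j+1)/2 + n - j + 1`, so this bound puts it beyond `q^n`.
  have : j ≤ j * (j + 1) / 2 := by
    rw [Nat.le_div_iff_mul_le (by simp)]
    rcases Nat.eq_zero_or_pos j with rfl | h0
    · simp
    · nlinarith
  omega

/-- The hypothesis holds for `a = z + z⁻¹` with `z` a primitive fifth root of unity, where `χ_j =
(z^{j+1} - z^{-j})/(z - 1)` depends only on `j` mod 5. -/
theorem thetaChar_add_five {a : R} (ha : a ^ 2 + a = 1) (j : ℕ) :
    thetaChar a (j + 5) = thetaChar a j := by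
  simp only [thetaChar]
  linear_combination
    ((a ^ 2 - a - 1) * thetaChar a (j + 1) - (a - 1) * thetaChar a j) * ha

theorem thetaChar_five_mul_add_two {a : R} (ha : a ^ 2 + a = 1) (k : ℕ) :
    thetaChar a (5 * k + 2) = 0 := by
  induction k with
  | zero => simp only [thetaChar]; linear_combination ha
  | succ k ih => rw [show 5 * (k + 1) + 2 = 5 * k + 2 + 5 by ring, thetaChar_add_five ha, ih]

theorem triangle_mod_five (j : ℕ) (h : j % 5 ≠ 2) :
    j * (j + 1) / 2 % 5 = 0 ∨ j * (j + 1) / 2 % 5 = 1 := by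
  have h2 : 2 * (j * (j + 1) / 2) = j * (j + 1) :=
    Nat.mul_div_cancel' (Nat.even_mul_succ_self j).two_dvd
  have h3 : (j * (j + 1)) % 5 = (j % 5) * (j % 5 + 1) % 5 := by
    simp [Nat.mul_mod, Nat.add_mod]
  have : j % 5 < 5 := Nat.mod_lt _ (by norm_num)
  interval_cases j % 5 <;> omega

theorem coeff_theta_eq_zero {a : R} (ha : a ^ 2 + a = 1) {m n : ℕ} (h : m ≤ n)
    (h0 : m % 5 ≠ 0) (h1 : m % 5 ≠ 1) :
    coeff m (eulerProd R n *
      ∏ i ∈ Finset.range n, (1 - C a * X ^ (i + 1) + X ^ (2 * (i + 1)))) = 0 := by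
  rw [coeff_eulerProd_mul_prod _ h, map_sum]
  refine Finset.sum_eq_zero fun j _ => ?_
  have hC : (C a : R⟦X⟧) ^ 2 + C a = 1 := by rw [← map_pow, ← map_add, ha, map_one]
  by_cases hj : j % 5 = 2
  · rw [show j = 5 * (j / 5) + 2 by omega, thetaChar_five_mul_add_two hC, mul_zero, map_zero]
  · have h2 := triangle_mod_five j hj
    have h3 : ∀ j, thetaChar (C a : R⟦X⟧) j = C (thetaChar a j) := by
      intro j
      induction j using Nat.twoStepInduction with
      | zero => simp [thetaChar]
      | one => simp [thetaChar]
      | more j ih1 ih2 => simp [thetaChar, ih1, ih2]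
    rw [h3, show ((-1) ^ j * X ^ (j * (j + 1) / 2) * C (thetaChar a j) : R⟦X⟧) =
      C ((-1) ^ j * thetaChar a j) * X ^ (j * (j + 1) / 2) by simp; ring, coeff_C_mul,
      coeff_X_pow, if_neg, mul_zero]
    rintro rfl
    omega

end FiniteTheta

/-! ### Infinite `q`-products and their exponents mod 5 -/

section Products

variable {R : Type*} [CommRing R] [TopologicalSpace R]

/-- `(z q^a; q^b)_∞ = ∏_{k ≥ 0} (1 - z q^(a + b k))` over a topological ring. -/
noncomputable def zPoch (z : R) (a b : ℕ) : R⟦X⟧ :=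
  ∏' k : ℕ, ((1 : R⟦X⟧) - C z * X ^ (a + b * k))

theorem zPoch_one_eq_qPoch (a b : ℕ) : zPoch (1 : ℤ) a b = qPoch a b := by
  simp [zPoch, qPoch]

theorem multipliable_zPoch (z : R) (a : ℕ) {b : ℕ} (hb : 0 < b) :
    Multipliable fun k : ℕ => (1 : R⟦X⟧) - C z * X ^ (a + b * k) := by
  simp_rw [sub_eq_add_neg]
  apply WithPiTopology.multipliable_one_add_of_tendsto_order_atTop_nhds_top
  refine ENat.tendsto_nhds_top_iff_natCast_lt.mpr
    (fun n => Filter.eventually_atTop.mpr ⟨n + 1, fun m hm => ?_⟩)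
  rw [order_neg]
  refine lt_of_lt_of_le ?_ (PowerSeries.le_order _ (a + b * m : ℕ) fun i hi => ?_)
  · norm_cast
    nlinarith
  · have hi : i < a + b * m := by exact_mod_cast hi
    rw [coeff_C_mul, coeff_X_pow, if_neg hi.ne, mul_zero]

theorem continuous_expand {p : ℕ} (hp : p ≠ 0) : Continuous (expand (R := R) p hp) := by
  rw [continuous_iff_continuousAt]
  intro f
  rw [ContinuousAt, WithPiTopology.tendsto_iff_coeff_tendsto]
  intro d
  simp only [coeff_expand]
  split_ifs
  · exact (WithPiTopology.continuous_coeff R (d / p)).continuousAt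
  · exact tendsto_const_nhds

theorem constantCoeff_zPoch [T2Space R] (z : R) {a b : ℕ} (ha : 0 < a) (hb : 0 < b) :
    constantCoeff (zPoch z a b) = 1 := by
  rw [zPoch, (multipliable_zPoch z a hb).map_tprod _ (WithPiTopology.continuous_constantCoeff R)]
  have h : ∀ k : ℕ, constantCoeff ((1 : R⟦X⟧) - C z * X ^ (a + b * k)) = 1 := by
    intro k
    have h0 : a + b * k ≠ 0 := by omega
    rw [map_sub, map_one, map_mul, map_pow, constantCoeff_X, zero_pow h0, mul_zero, sub_zero]
  simp [h]

theorem expand_zPoch [T2Space R] (z : R) (a : ℕ) {b p : ℕ} (hb : 0 < b) (hp : p ≠ 0) :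
    expand p hp (zPoch z a b) = zPoch z (p * a) (p * b) := by
  rw [zPoch, (multipliable_zPoch z a hb).map_tprod _ (continuous_expand hp), zPoch]
  refine tprod_congr fun k => ?_
  rw [map_sub, map_one, map_mul, map_pow, expand_C, expand_X, ← pow_mul]
  ring_nf

theorem coeff_zPoch_one_one_eq_zero [T2Space R] {m : ℕ} (h3 : m % 5 = 3 ∨ m % 5 = 4) :
    coeff m (zPoch (1 : R) 1 1) = 0 := by
  have h : zPoch (1 : R) 1 1 = pentagonalSeries R := by
    rw [← WithPiTopology.tprod_one_sub_X_pow, zPoch]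
    refine tprod_congr fun k => ?_
    simp [add_comm]
  rw [h, coeff_pentagonalSeries_eq_zero]
  rintro ⟨k, rfl⟩
  have h2 := two_mul_natCast_pentagonal k
  have h4 : k * (3 * k - 1) % 5 = (k % 5) * (3 * (k % 5) - 1) % 5 := by
    simp [Int.mul_emod, Int.sub_emod]
  have h5 : 0 ≤ k % 5 := Int.emod_nonneg _ (by norm_num)
  have h6 : k % 5 < 5 := Int.emod_lt_of_pos _ (by norm_num)
  -- Generalized pentagonal numbers are 0, 1 or 2 mod 5.
  interval_cases k % 5 <;> omega

variable [IsTopologicalRing R] [T2Space R]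

theorem zPoch_even_mul_odd : zPoch (1 : R) 2 2 * zPoch 1 1 2 = zPoch 1 1 1 := by
  have h := tprod_even_mul_odd (f := fun k : ℕ => (1 : R⟦X⟧) - C 1 * X ^ (1 + 1 * k))
    ((multipliable_zPoch 1 1 two_pos).congr fun k => by ring_nf)
    ((multipliable_zPoch 1 2 two_pos).congr fun k => by ring_nf)
  rw [mul_comm, zPoch, zPoch, zPoch, ← h]
  congr 1 <;> refine tprod_congr fun k => ?_ <;> ring_nf

theorem zPoch_mul_five {z : R} (hz : 1 + z + z ^ 2 + z ^ 3 + z ^ 4 = 0) (a : ℕ) {b : ℕ}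
    (hb : 0 < b) :
    zPoch 1 a b * zPoch z a b * zPoch (z ^ 2) a b * zPoch (z ^ 3) a b * zPoch (z ^ 4) a b =
      zPoch 1 (5 * a) (5 * b) := by
  have m := fun y : R => multipliable_zPoch y a hb
  simp only [zPoch]
  rw [← (m _).tprod_mul (m _), ← ((m _).mul (m _)).tprod_mul (m _),
    ← (((m _).mul (m _)).mul (m _)).tprod_mul (m _),
    ← ((((m _).mul (m _)).mul (m _)).mul (m _)).tprod_mul (m _)]
  refine tprod_congr fun k => ?_
  have hC : (1 + C z + C z ^ 2 + C z ^ 3 + C z ^ 4 : R⟦X⟧) = 0 := by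
    rw [← map_zero C, ← hz]; simp
  have e : (X : R⟦X⟧) ^ (5 * a + 5 * b * k) = (X ^ (a + b * k)) ^ 5 := by rw [← pow_mul]; ring_nf
  rw [e]
  simp only [map_pow, map_one, one_mul]
  generalize (X : R⟦X⟧) ^ (a + b * k) = x
  generalize (C z : R⟦X⟧) = y at hC
  have h5 : y ^ 5 = 1 := by linear_combination (y - 1) * hC
  have h4 : y ^ 4 = -(1 + y + y ^ 2 + y ^ 3) := by linear_combination hC
  -- Conjugate factors are paired; the sums `y + y⁴` and `y² + y³` have sum and product `-1`.
  have e1 : (1 - y * x) * (1 - y ^ 4 * x) = 1 - (y + y ^ 4) * x + x ^ 2 := by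
    linear_combination x ^ 2 * h5
  have e2 : (1 - y ^ 2 * x) * (1 - y ^ 3 * x) = 1 - (y ^ 2 + y ^ 3) * x + x ^ 2 := by
    linear_combination x ^ 2 * h5
  have e3 : (y + y ^ 4) * (y ^ 2 + y ^ 3) = -1 := by
    linear_combination (y + y ^ 2) * h5 + hC
  calc _ = (1 - x) * ((1 - y * x) * (1 - y ^ 4 * x)) * ((1 - y ^ 2 * x) * (1 - y ^ 3 * x)) := by
        ring
    _ = _ := by
      rw [e1, e2]
      linear_combination (-x - x ^ 3 + x ^ 2 + x ^ 4) * hC + (1 - x) * x ^ 2 * e3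

theorem coeff_zPoch_theta_eq_zero {z : R} (hz : 1 + z + z ^ 2 + z ^ 3 + z ^ 4 = 0) {m : ℕ}
    (h0 : m % 5 ≠ 0) (h1 : m % 5 ≠ 1) :
    coeff m (zPoch (1 : R) 1 1 * zPoch z 1 1 * zPoch (z ^ 4) 1 1) = 0 := by
  have mz := fun y : R => multipliable_zPoch y 1 one_pos
  simp only [zPoch]
  rw [← (mz _).tprod_mul (mz _), ← ((mz _).mul (mz _)).tprod_mul (mz _)]
  have ht := ((((mz 1).mul (mz z)).mul (mz (z ^ 4))).hasProd.tendsto_prod_nat)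
  rw [WithPiTopology.tendsto_iff_coeff_tendsto] at ht
  -- The `m`-th coefficient of every partial product with at least `m` factors is already zero.
  refine tendsto_nhds_unique (ht m) (tendsto_const_nhds.congr' ?_)
  filter_upwards [Filter.eventually_ge_atTop m] with n hn
  have ha : (z + z ^ 4) ^ 2 + (z + z ^ 4) = 1 := by
    linear_combination (1 + (z - 1) * (2 + z ^ 3)) * hz
  rw [← coeff_theta_eq_zero ha hn h0 h1, eulerProd, ← Finset.prod_mul_distrib]
  congr 1
  refine Finset.prod_congr rfl fun i _ => ?_
  have hC : (C z : R⟦X⟧) ^ 5 = 1 := by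
    rw [← map_pow, ← map_one C]; congr 1; linear_combination (z - 1) * hz
  simp only [map_pow, map_one, one_mul, map_add, pow_mul', add_comm 1 i]
  linear_combination -(1 - X ^ (i + 1)) * X ^ (i + 1) * X ^ (i + 1) * hC

/-- If `F * G` has no coefficients in the class `r` mod `p`, where `G` is a power series in `q^p`
with constant coefficient `1`, then neither does `F`. -/
theorem coeff_eq_zero_of_mul_expand {S : Type*} [CommRing S] {p : ℕ} (hp : p ≠ 0) {F G H : S⟦X⟧}
    (hG : constantCoeff G = 1) (hFG : F * expand p hp G = H) {r : ℕ}
    (hH : ∀ n, n % p = r → coeff n H = 0) (n : ℕ) (hn : n % p = r) : coeff n F = 0 := by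
  have hu : expand p hp G * expand p hp (invOfUnit G 1) = 1 := by
    rw [← map_mul, mul_invOfUnit _ _ (by simpa using hG), map_one]
  have hF : F = H * expand p hp (invOfUnit G 1) := by rw [← hFG, mul_assoc, hu, mul_one]
  rw [hF, coeff_mul]
  refine Finset.sum_eq_zero fun ij hij => ?_
  have hij := Finset.HasAntidiagonal.mem_antidiagonal.mp hij
  by_cases hd : p ∣ ij.2
  · obtain ⟨k, hk⟩ := hd
    rw [hH ij.1, zero_mul]
    rw [← hn, ← hij, hk, Nat.add_mul_mod_self_left]
  · rw [coeff_expand_of_not_dvd _ _ _ hd, mul_zero]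

end Products

/-! ### Generating functions of weighted sets and of partitions -/

section SizeGenFun

variable {R : Type*} [CommRing R] {α β : Type*}

/-- The generating function `∑_a w(a) q^(s(a))` of a set with a size function `s` with finite
fibres and a weight function `w`. -/
noncomputable def sizeGenFun (s : α → ℕ) (w : α → R) : R⟦X⟧ :=
  PowerSeries.mk fun n => ∑ᶠ a ∈ {a | s a = n}, w a

theorem coeff_sizeGenFun (s : α → ℕ) (w : α → R) (n : ℕ) :
    coeff n (sizeGenFun s w) = ∑ᶠ a ∈ {a | s a = n}, w a :=
  coeff_mk _ _

theorem finite_fiber_prod {s : α → ℕ} {s' : β → ℕ} (hs : ∀ n, {a | s a = n}.Finite)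
    (hs' : ∀ n, {b | s' b = n}.Finite) (n : ℕ) :
    {p : α × β | s p.1 + s' p.2 = n}.Finite := by
  have h : {p : α × β | s p.1 + s' p.2 = n} ⊆
      ⋃ i ∈ Finset.range (n + 1), ⋃ j ∈ Finset.range (n + 1),
        {a | s a = i} ×ˢ {b | s' b = j} := by
    rintro ⟨a, b⟩ hab
    have hab : s a + s' b = n := hab
    simp only [Set.mem_iUnion]
    exact ⟨s a, Finset.mem_range.mpr (by omega), s' b, Finset.mem_range.mpr (by omega), rfl, rfl⟩
  exact (Set.Finite.biUnion (Finset.finite_toSet _) fun i _ =>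
    Set.Finite.biUnion (Finset.finite_toSet _) fun j _ => (hs i).prod (hs' j)).subset h

theorem sizeGenFun_mul {s : α → ℕ} {s' : β → ℕ} (hs : ∀ n, {a | s a = n}.Finite)
    (hs' : ∀ n, {b | s' b = n}.Finite) (w : α → R) (w' : β → R) :
    sizeGenFun s w * sizeGenFun s' w' =
      sizeGenFun (fun p : α × β => s p.1 + s' p.2) (fun p => w p.1 * w' p.2) := by
  classical
  ext n
  simp only [coeff_mul, coeff_sizeGenFun]
  rw [finsum_mem_eq_finite_toFinset_sum _ (finite_fiber_prod hs hs' n)]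
  have hmap : ∀ p ∈ (finite_fiber_prod hs hs' n).toFinset,
      (s p.1, s' p.2) ∈ Finset.HasAntidiagonal.antidiagonal n := by
    intro p hp
    simpa using hp
  rw [← Finset.sum_fiberwise_of_maps_to hmap]
  refine Finset.sum_congr rfl fun ij hij => ?_
  rw [finsum_mem_eq_finite_toFinset_sum _ (hs _), finsum_mem_eq_finite_toFinset_sum _ (hs' _),
    Finset.sum_mul_sum, ← Finset.sum_product']
  refine Finset.sum_congr ?_ fun _ _ => rfl
  ext ⟨a, b⟩
  have hij : ij.1 + ij.2 = n := by simpa using hij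
  simp only [Finset.mem_product, Set.Finite.mem_toFinset, Set.mem_ofPred_eq, Finset.mem_filter,
    Prod.ext_iff]
  constructor
  · rintro ⟨h1, h2⟩
    exact ⟨by omega, h1, h2⟩
  · exact fun h => h.2

/-- Lets constraints on the components be traded for zero weights, so that vector partitions can be
counted on a full product of copies of `Ptn`. -/
theorem sizeGenFun_comp {f : α → β} (hf : Function.Injective f) (s : β → ℕ) (w : β → R)
    (hw : ∀ b, w b ≠ 0 → b ∈ Set.range f) :
    sizeGenFun (fun a => s (f a)) (fun a => w (f a)) = sizeGenFun s w := by
  ext n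
  simp only [coeff_sizeGenFun]
  rw [← finsum_mem_image hf.injOn (s := {a | s (f a) = n}) (f := w)]
  refine finsum_mem_inter_support_eq _ _ _ ?_
  ext b
  simp only [Set.mem_inter_iff, Set.mem_image, Set.mem_ofPred_eq, Function.mem_support]
  constructor
  · rintro ⟨⟨a, ha, rfl⟩, h⟩
    exact ⟨ha, h⟩
  · rintro ⟨hb, h⟩
    obtain ⟨a, rfl⟩ := hw b h
    exact ⟨⟨a, hb, rfl⟩, h⟩

theorem expand_sizeGenFun (s : α → ℕ) (w : α → R) {p : ℕ} (hp : p ≠ 0) :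
    expand p hp (sizeGenFun s w) = sizeGenFun (fun a => p * s a) w := by
  ext n
  rw [coeff_expand, coeff_sizeGenFun fun a => p * s a]
  split_ifs with h
  · obtain ⟨k, rfl⟩ := h
    rw [coeff_sizeGenFun, Nat.mul_div_cancel_left _ (Nat.pos_of_ne_zero hp)]
    simp only [mul_right_inj' hp]
  · symm
    refine finsum_mem_eq_zero_of_forall_eq_zero fun a ha => ?_
    exact absurd ⟨s a, Eq.symm ha⟩ h

theorem Ptn.size_mk {n : ℕ} (p : Nat.Partition n) : Ptn.size ⟨n, p⟩ = n := p.parts_sum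

theorem Ptn.finite_size_eq (n : ℕ) : {p : Ptn | p.size = n}.Finite :=
  (Ptn.finite_size_le n).subset fun _ hp => le_of_eq hp

theorem Ptn.finite_mul_size_eq {t : ℕ} (ht : 0 < t) (n : ℕ) : {p : Ptn | t * p.size = n}.Finite :=
  (Ptn.finite_size_le n).subset fun p hp => (Nat.le_mul_of_pos_left p.size ht).trans (le_of_eq hp)

theorem coeff_sizeGenFun_ptn (w : Ptn → R) (n : ℕ) :
    coeff n (sizeGenFun Ptn.size w) = ∑ p : Nat.Partition n, w ⟨n, p⟩ := by
  rw [coeff_sizeGenFun, ← finsum_eq_sum_of_fintype,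
    ← finsum_mem_range (f := w) (g := fun p : Nat.Partition n => (⟨n, p⟩ : Ptn))
      sigma_mk_injective]
  congr 1
  ext p
  have : p ∈ {a : Ptn | a.size = n} ↔
      p ∈ Set.range (fun p : Nat.Partition n => (⟨n, p⟩ : Ptn)) := by
    constructor
    · intro h
      obtain ⟨m, p⟩ := p
      have h : Ptn.size ⟨m, p⟩ = n := h
      rw [Ptn.size_mk] at h
      subst h
      exact ⟨p, rfl⟩
    · rintro ⟨p, rfl⟩
      exact Ptn.size_mk p
  simp only [this]

/-- The weight `z^ℓ(λ)` on the partitions with parts satisfying `P`. -/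
noncomputable def partsWeight (P : ℕ → Prop) (z : R) (p : Ptn) : R :=
  open Classical in if ∀ i ∈ p.parts, P i then z ^ p.length else 0

/-- The weight `(-1)^ℓ(λ)` on the partitions into distinct even parts. -/
noncomputable def distinctEvenWeight (R : Type*) [CommRing R] (p : Ptn) : R :=
  open Classical in if p.IsDistinctEven then (-1) ^ p.length else 0

open Classical in
theorem sizeGenFun_partsWeight_eq_genFun (P : ℕ → Prop) (z : R) :
    sizeGenFun Ptn.size (partsWeight P z) =
      Nat.Partition.genFun fun i c => if P i then z ^ c else 0 := by
  ext n
  rw [coeff_sizeGenFun_ptn, Nat.Partition.coeff_genFun]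
  refine Finset.sum_congr rfl fun p _ => ?_
  rw [Finsupp.prod, Multiset.toFinsupp_support]
  simp only [Multiset.toFinsupp_apply]
  by_cases h : ∀ i ∈ p.parts, P i
  · rw [partsWeight, if_pos (show ∀ i ∈ Ptn.parts ⟨n, p⟩, P i from h),
      Finset.prod_congr rfl fun i hi => if_pos (h i (Multiset.mem_toFinset.mp hi)),
      Finset.prod_pow_eq_pow_sum, Multiset.toFinset_sum_count_eq]
    rfl
  · rw [partsWeight, if_neg (show ¬ ∀ i ∈ Ptn.parts ⟨n, p⟩, P i from h)]
    push Not at h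
    obtain ⟨i, hi, hP⟩ := h
    exact (Finset.prod_eq_zero (Multiset.mem_toFinset.mpr hi) (by simp [hP])).symm

open Classical in
theorem sizeGenFun_distinctEvenWeight_eq_genFun :
    sizeGenFun Ptn.size (distinctEvenWeight R) =
      Nat.Partition.genFun fun i c => if Even i ∧ c = 1 then -1 else 0 := by
  ext n
  rw [coeff_sizeGenFun_ptn, Nat.Partition.coeff_genFun]
  refine Finset.sum_congr rfl fun p _ => ?_
  rw [Finsupp.prod, Multiset.toFinsupp_support]
  simp only [Multiset.toFinsupp_apply]
  by_cases h : ∀ i ∈ p.parts, Even i ∧ p.parts.count i = 1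
  · have h1 : p.parts.Nodup := Multiset.nodup_iff_count_eq_one.mpr fun i hi => (h i hi).2
    rw [distinctEvenWeight, if_pos (show Ptn.IsDistinctEven ⟨n, p⟩ from
      ⟨h1, fun i hi => (h i hi).1⟩)]
    refine Eq.trans ?_ (Finset.prod_congr (g := fun _ => (-1 : R)) rfl
      fun i hi => if_pos (h i (Multiset.mem_toFinset.mp hi))).symm
    rw [Finset.prod_const, Multiset.toFinset_card_of_nodup h1]
    rfl
  · rw [distinctEvenWeight, if_neg fun h1 : Ptn.IsDistinctEven ⟨n, p⟩ =>
      h fun i hi => ⟨h1.2 i hi, Multiset.nodup_iff_count_eq_one.mp h1.1 i hi⟩]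
    push Not at h
    obtain ⟨i, hi, hP⟩ := h
    exact (Finset.prod_eq_zero (Multiset.mem_toFinset.mpr hi)
      (if_neg fun h => hP h.1 h.2)).symm

variable [TopologicalSpace R]

open Classical in
theorem hasProd_ite_zPoch (z : R) {P : ℕ → Prop} {a b : ℕ} (ha : 0 < a) (hb : 0 < b)
    (hP : ∀ i, P i ∧ 0 < i ↔ ∃ k, i = a + b * k) :
    HasProd (fun i : ℕ => if P (i + 1) then (1 : R⟦X⟧) - C z * X ^ (i + 1) else 1)
      (zPoch z a b) := by
  -- Index `i` of the product stands for part size `i + 1`, hence the shift by one.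
  have hinj : Function.Injective fun k : ℕ => a + b * k - 1 := by
    intro k l h
    have h : a + b * k - 1 = a + b * l - 1 := h
    exact Nat.eq_of_mul_eq_mul_left hb (by omega)
  have he : ∀ k, a + b * k - 1 + 1 = a + b * k := fun k => by omega
  rw [← hinj.hasProd_iff]
  · refine (multipliable_zPoch z a hb).hasProd.congr_fun fun k => ?_
    simp only [Function.comp_apply, he]
    rw [if_pos ((hP _).mpr ⟨k, rfl⟩).1]
  · intro i hi
    rw [if_neg]
    intro h
    obtain ⟨k, hk⟩ := (hP _).mp ⟨h, Nat.succ_pos i⟩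
    exact hi ⟨k, by simp only; omega⟩

theorem sizeGenFun_distinctEvenWeight [T2Space R] :
    sizeGenFun Ptn.size (distinctEvenWeight R) = zPoch 1 2 2 := by
  classical
  rw [sizeGenFun_distinctEvenWeight_eq_genFun]
  have hE : ∀ i, Even i ∧ 0 < i ↔ ∃ k, i = 2 + 2 * k := by
    intro i
    constructor
    · rintro ⟨⟨k, rfl⟩, h⟩
      exact ⟨k - 1, by omega⟩
    · rintro ⟨k, rfl⟩
      exact ⟨⟨1 + k, by ring⟩, by omega⟩
  refine (Nat.Partition.hasProd_genFun _).unique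
    ((hasProd_ite_zPoch 1 two_pos two_pos hE).congr_fun fun i => ?_)
  -- Index `j` of the sum is multiplicity `j + 1`; distinctness leaves only `j = 0`.
  rw [tsum_eq_single 0]
  · by_cases h : Even (i + 1) <;> simp [h, sub_eq_add_neg]
  · intro j hj
    simp [hj]

variable [IsTopologicalRing R] [T2Space R]

/-- Each allowed part size contributes a geometric series, cancelled by its own factor `1 - z q^i`.
-/
theorem sizeGenFun_partsWeight_mul_zPoch (z : R) {P : ℕ → Prop} {a b : ℕ} (ha : 0 < a)
    (hb : 0 < b) (hP : ∀ i, P i ∧ 0 < i ↔ ∃ k, i = a + b * k) :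
    sizeGenFun Ptn.size (partsWeight P z) * zPoch z a b = 1 := by
  classical
  rw [sizeGenFun_partsWeight_eq_genFun]
  have h := (Nat.Partition.hasProd_genFun fun i c => if P i then z ^ c else 0).mul
    (hasProd_ite_zPoch z ha hb hP)
  refine h.unique (hasProd_one.congr_fun fun i => ?_)
  by_cases h : P (i + 1)
  · have hc : constantCoeff (C z * X ^ (i + 1) : R⟦X⟧) = 0 := by simp
    have h1 := WithPiTopology.tsum_pow_mul_one_sub_of_constantCoeff_eq_zero hc
    rw [(WithPiTopology.summable_pow_of_constantCoeff_eq_zero hc).tsum_eq_zero_add, pow_zero] at h1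
    simp only [h, if_true]
    rw [← h1]
    congr 2
    refine tsum_congr fun j => ?_
    rw [smul_eq_C_mul, mul_pow, ← pow_mul, map_pow]
  · simp [h]

end SizeGenFun

/-! ### The multirank generating function at fifth roots of unity -/

section VectorGenFun

variable {R : Type*} [CommRing R]

namespace VectorPartition

/-- The components of a vector partition, as a nested tuple. -/
def toTuple (v : VectorPartition) : (((((Ptn × Ptn) × Ptn) × Ptn) × Ptn) × Ptn) × Ptn :=
  ((((((v.l₁, v.l₂), v.l₃), v.l₄), v.l₅), v.l₆), v.l₇)

theorem toTuple_injective : Function.Injective toTuple := by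
  intro v v' h
  simp only [toTuple, Prod.mk.injEq] at h
  obtain ⟨⟨⟨⟨⟨⟨h1, h2⟩, h3⟩, h4⟩, h5⟩, h6⟩, h7⟩ := h
  exact VectorPartition.ext h1 h2 h3 h4 h5 h6 h7

/-- A natural number congruent to the multirank modulo `5`. -/
def rankExponent (v : VectorPartition) : ℕ :=
  v.l₂.length + 4 * v.l₃.length + 2 * v.l₄.length + 3 * v.l₅.length + 2 * v.l₆.length +
    3 * v.l₇.length

/-- Replacing `-1` by `4` and `-2` by `3` keeps the exponents of `z` natural, at no cost when `z⁵ =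
1`. -/
theorem multirank_modEq_iff (v : VectorPartition) (i : ℕ) (hi : i < 5) :
    multirank v ≡ i [ZMOD (5 : ℕ)] ↔ v.rankExponent % 5 = i := by
  rw [multirank, rankExponent, Int.ModEq]
  omega

end VectorPartition

open VectorPartition

theorem sizeGenFun_vectorPartition {t : ℕ} (ht : 0 < t) (z : R) :
    sizeGenFun (VectorPartition.s t) (fun v => (wt v : R) * z ^ v.rankExponent) =
      sizeGenFun Ptn.size (distinctEvenWeight R) *
      sizeGenFun Ptn.size (partsWeight Odd z) *
      sizeGenFun Ptn.size (partsWeight Odd (z ^ 4)) *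
      sizeGenFun Ptn.size (partsWeight Odd (z ^ 2)) *
      sizeGenFun Ptn.size (partsWeight Odd (z ^ 3)) *
      sizeGenFun (fun p => t * Ptn.size p) (partsWeight (fun _ => True) (z ^ 2)) *
      sizeGenFun (fun p => t * Ptn.size p) (partsWeight (fun _ => True) (z ^ 3)) := by
  have f1 := Ptn.finite_size_eq
  have f2 := finite_fiber_prod f1 f1
  have f3 := finite_fiber_prod f2 f1
  have f4 := finite_fiber_prod f3 f1
  have f5 := finite_fiber_prod f4 f1
  have f6 := finite_fiber_prod f5 (Ptn.finite_mul_size_eq ht)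
  rw [sizeGenFun_mul f1 f1, sizeGenFun_mul f2 f1, sizeGenFun_mul f3 f1, sizeGenFun_mul f4 f1,
    sizeGenFun_mul f5 (Ptn.finite_mul_size_eq ht), sizeGenFun_mul f6 (Ptn.finite_mul_size_eq ht),
    ← sizeGenFun_comp toTuple_injective]
  · congr 1
    funext v
    have hO : ∀ (y : R) {p : Ptn}, p.IsOdd → partsWeight Odd y p = y ^ p.length :=
      fun y p hp => if_pos hp
    have hT : ∀ (y : R) (p : Ptn), partsWeight (fun _ => True) y p = y ^ p.length :=
      fun y p => if_pos fun _ _ => trivial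
    have hD : distinctEvenWeight R v.l₁ = (-1) ^ v.l₁.length := if_pos v.distinctEven₁
    simp only [toTuple, hD, hO _ v.odd₂, hO _ v.odd₃, hO _ v.odd₄, hO _ v.odd₅, hT, wt,
      rankExponent]
    push_cast
    ring
  · rintro ⟨⟨⟨⟨⟨⟨p1, p2⟩, p3⟩, p4⟩, p5⟩, p6⟩, p7⟩ h
    have hp : ∀ (y : R) (p : Ptn), partsWeight Odd y p ≠ 0 → p.IsOdd := by
      intro y p h
      by_contra h0
      exact h (if_neg h0)
    have hd : distinctEvenWeight R p1 ≠ 0 → p1.IsDistinctEven := by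
      intro h
      by_contra h0
      exact h (if_neg h0)
    have h6 := left_ne_zero_of_mul (left_ne_zero_of_mul h)
    have h5 := left_ne_zero_of_mul h6
    have h4 := left_ne_zero_of_mul h5
    have h3 := left_ne_zero_of_mul h4
    exact ⟨⟨p1, p2, p3, p4, p5, p6, p7, hd (left_ne_zero_of_mul h3),
      hp _ _ (right_ne_zero_of_mul h3), hp _ _ (right_ne_zero_of_mul h4),
      hp _ _ (right_ne_zero_of_mul h5), hp _ _ (right_ne_zero_of_mul h6)⟩, rfl⟩

theorem sizeGenFun_vectorPartition_mul [TopologicalSpace R] [IsTopologicalRing R] [T2Space R]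
    {t : ℕ} (ht : 0 < t) (z : R) :
    sizeGenFun (VectorPartition.s t) (fun v => (wt v : R) * z ^ v.rankExponent) *
      (zPoch z 1 2 * zPoch (z ^ 4) 1 2 * zPoch (z ^ 2) 1 2 * zPoch (z ^ 3) 1 2 *
        (zPoch (z ^ 2) t t * zPoch (z ^ 3) t t)) = zPoch 1 2 2 := by
  have hO : ∀ i, Odd i ∧ 0 < i ↔ ∃ k, i = 1 + 2 * k := fun i =>
    ⟨fun ⟨⟨k, hk⟩, _⟩ => ⟨k, by omega⟩, fun ⟨k, hk⟩ => ⟨⟨k, by omega⟩, by omega⟩⟩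
  have hT : ∀ i, True ∧ 0 < i ↔ ∃ k, i = 1 + 1 * k := fun i =>
    ⟨fun ⟨_, h⟩ => ⟨i - 1, by omega⟩, fun ⟨k, hk⟩ => ⟨trivial, by omega⟩⟩
  have odd := fun y : R => sizeGenFun_partsWeight_mul_zPoch y one_pos two_pos hO
  have all : ∀ y : R, sizeGenFun (fun p => t * Ptn.size p) (partsWeight (fun _ => True) y) *
      zPoch y t t = 1 := by
    intro y
    have h := congrArg (expand t ht.ne')
      (sizeGenFun_partsWeight_mul_zPoch (P := fun _ => True) y one_pos one_pos hT)
    rwa [map_mul, map_one, expand_sizeGenFun, expand_zPoch _ _ one_pos, mul_one] at h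
  rw [sizeGenFun_vectorPartition ht, sizeGenFun_distinctEvenWeight]
  have h1 := odd z
  have h2 := odd (z ^ 4)
  have h3 := odd (z ^ 2)
  have h4 := odd (z ^ 3)
  have h5 := all (z ^ 2)
  have h6 := all (z ^ 3)
  generalize sizeGenFun Ptn.size (partsWeight Odd z) = A1 at *
  generalize sizeGenFun Ptn.size (partsWeight Odd (z ^ 4)) = A2 at *
  generalize sizeGenFun Ptn.size (partsWeight Odd (z ^ 2)) = A3 at *
  generalize sizeGenFun Ptn.size (partsWeight Odd (z ^ 3)) = A4 at *
  generalize sizeGenFun (fun p => t * Ptn.size p) (partsWeight (fun _ => True) (z ^ 2)) = A5 at *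
  generalize sizeGenFun (fun p => t * Ptn.size p) (partsWeight (fun _ => True) (z ^ 3)) = A6 at *
  calc _ = zPoch 1 2 2 * (A1 * zPoch z 1 2) * (A2 * zPoch (z ^ 4) 1 2) *
        (A3 * zPoch (z ^ 2) 1 2) * (A4 * zPoch (z ^ 3) 1 2) *
        (A5 * zPoch (z ^ 2) t t) * (A6 * zPoch (z ^ 3) t t) := by ring
    _ = _ := by rw [h1, h2, h3, h4, h5, h6]; simp only [mul_one]

theorem coeff_sizeGenFun_vectorPartition {t : ℕ} (ht : 0 < t) {z : R} (hz : z ^ 5 = 1) (n : ℕ) :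
    coeff n (sizeGenFun (VectorPartition.s t) (fun v => (wt v : R) * z ^ v.rankExponent)) =
      ∑ i ∈ Finset.range 5, (N t i 5 n : R) * z ^ i := by
  classical
  have hfin := VectorPartition.finite_s_eq ht n
  rw [coeff_sizeGenFun, finsum_mem_eq_finite_toFinset_sum _ hfin,
    ← Finset.sum_fiberwise_of_maps_to (g := fun v => v.rankExponent % 5)
      (t := Finset.range 5) fun v _ => Finset.mem_range.mpr (Nat.mod_lt _ (by norm_num))]
  refine Finset.sum_congr rfl fun i hi => ?_
  have hi := Finset.mem_range.mp hi
  have hsub : {v : VectorPartition | v.s t = n ∧ multirank v ≡ i [ZMOD (5 : ℕ)]}.Finite :=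
    hfin.subset fun v hv => hv.1
  rw [N, finsum_mem_eq_finite_toFinset_sum _ hsub, Int.cast_sum, Finset.sum_mul]
  refine Finset.sum_congr ?_ fun v hv => ?_
  · ext v
    simp only [Finset.mem_filter, Set.Finite.mem_toFinset, Set.mem_ofPred_eq,
      multirank_modEq_iff v i hi]
  · have h1 := (multirank_modEq_iff v i hi).mp ((Set.Finite.mem_toFinset _).mp hv).2
    rw [← Nat.mod_add_div v.rankExponent 5, h1, pow_add, pow_mul, hz, one_pow, mul_one]

theorem sum_N_eq_w {t : ℕ} (ht : 0 < t) (n : ℕ) :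
    ∑ i ∈ Finset.range 5, N t i 5 n = w t n := by
  have h1 := coeff_sizeGenFun_vectorPartition (R := ℤ) ht (one_pow 5) n
  have h2 := sizeGenFun_vectorPartition_mul (R := ℤ) ht 1
  simp only [one_pow, mul_one, Int.cast_id] at h1 h2
  rw [← h1, w, ← zPoch_one_eq_qPoch 2 2, ← h2]
  have h3 : genFunDenominator t = zPoch (1 : ℤ) 1 2 * zPoch 1 1 2 * zPoch 1 1 2 * zPoch 1 1 2 *
      (zPoch 1 t t * zPoch 1 t t) := by
    rw [genFunDenominator, zPoch_one_eq_qPoch, zPoch_one_eq_qPoch]; ring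
  rw [← h3, mul_assoc, mul_invOfUnit, mul_one]
  simp [genFunDenominator, constantCoeff_qPoch, ht]

/-- The denominators lack `(q;q²)` and `(q^t;q^t)(z q^t;q^t)(z⁴ q^t;q^t)` to become series in `q⁵`.
The former turns the numerator `(q²;q²)` into `(q;q)`; the latter is the theta product in `q^t`. -/
theorem sizeGenFun_vectorPartition_mul_expand [TopologicalSpace R] [IsTopologicalRing R]
    [T2Space R] {t : ℕ} (ht : 0 < t) {z : R} (hz : 1 + z + z ^ 2 + z ^ 3 + z ^ 4 = 0) :
    sizeGenFun (VectorPartition.s t) (fun v => (wt v : R) * z ^ v.rankExponent) *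
      expand 5 (by norm_num) (zPoch 1 1 2 * zPoch 1 t t) =
    zPoch 1 1 1 * expand t ht.ne' (zPoch 1 1 1 * zPoch z 1 1 * zPoch (z ^ 4) 1 1) := by
  have h := sizeGenFun_vectorPartition_mul ht z
  have h1 := zPoch_mul_five hz 1 two_pos
  have h2 := zPoch_mul_five hz t ht
  rw [map_mul, expand_zPoch _ _ two_pos, expand_zPoch _ _ ht, ← h1, ← h2, map_mul, map_mul,
    expand_zPoch _ _ one_pos, expand_zPoch _ _ one_pos, expand_zPoch _ _ one_pos,
    ← zPoch_even_mul_odd, ← h, mul_one]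
  ring

theorem coeff_mul_expand_eq_zero {A B : R⟦X⟧} {t n : ℕ} (ht : t ≠ 0)
    (hA : ∀ m, m % 5 = 3 ∨ m % 5 = 4 → coeff m A = 0)
    (hB : ∀ m, m % 5 ≠ 0 → m % 5 ≠ 1 → coeff m B = 0)
    (h0 : n % 5 = 3 ∨ n % 5 = 4) (h1 : ∀ i < 3, (i + t) % 5 ≠ n % 5) :
    coeff n (A * expand t ht B) = 0 := by
  rw [coeff_mul]
  refine Finset.sum_eq_zero fun ij hij => ?_
  have hij := Finset.HasAntidiagonal.mem_antidiagonal.mp hij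
  by_cases hi : ij.1 % 5 = 3 ∨ ij.1 % 5 = 4
  · rw [hA _ hi, zero_mul]
  rw [coeff_expand]
  split_ifs with hd
  · obtain ⟨k, hk⟩ := hd
    rw [hk, Nat.mul_div_cancel_left _ (Nat.pos_of_ne_zero ht), hB, mul_zero]
    · intro hk0
      have : (t * k) % 5 = 0 := by rw [Nat.mul_mod, hk0]; simp
      omega
    · intro hk0
      have : (t * k) % 5 = t % 5 := by rw [Nat.mul_mod, hk0]; simp
      -- The first factor contributes a residue below 3, the second contributes `t`.
      have := h1 (ij.1 % 5) (by omega)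
      omega
  · rw [mul_zero]

theorem coeff_sizeGenFun_vectorPartition_eq_zero [TopologicalSpace R] [IsTopologicalRing R]
    [T2Space R] {t : ℕ} (ht : 0 < t) {z : R} (hz : 1 + z + z ^ 2 + z ^ 3 + z ^ 4 = 0) {n : ℕ}
    (h0 : n % 5 = 3 ∨ n % 5 = 4) (h1 : ∀ i < 3, (i + t) % 5 ≠ n % 5) :
    coeff n (sizeGenFun (VectorPartition.s t) (fun v => (wt v : R) * z ^ v.rankExponent)) = 0 := by
  refine coeff_eq_zero_of_mul_expand (by norm_num) ?_
    (sizeGenFun_vectorPartition_mul_expand ht hz) (r := n % 5) (fun m hm => ?_) n rfl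
  · rw [map_mul, constantCoeff_zPoch _ one_pos two_pos, constantCoeff_zPoch _ ht ht, one_mul]
  · exact coeff_mul_expand_eq_zero ht.ne' (fun _ => coeff_zPoch_one_one_eq_zero)
      (fun _ => coeff_zPoch_theta_eq_zero hz) (by rwa [hm]) (by rwa [hm])

end VectorGenFun

/-! ### From vanishing coefficients to equidistribution -/

theorem eq_of_sum_mul_primitiveRoot_eq_zero {ζ : ℂ} (hζ : IsPrimitiveRoot ζ 5) (c : ℕ → ℤ)
    (h : ∑ i ∈ Finset.range 5, (c i : ℂ) * ζ ^ i = 0) (i : ℕ) (hi : i < 5) : c i = c 4 := by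
  have hz : 1 + ζ + ζ ^ 2 + ζ ^ 3 + ζ ^ 4 = 0 := by
    have := hζ.geom_sum_eq_zero (by norm_num)
    simpa [Finset.sum_range_succ] using this
  -- Subtracting `c 4` times `1 + ζ + ⋯ + ζ⁴ = 0` removes the top term, leaving a degree below that
  -- of the minimal polynomial.
  let p : Polynomial ℚ := ∑ i ∈ Finset.range 4, Polynomial.monomial i ((c i : ℚ) - c 4)
  have hp : Polynomial.aeval ζ p = 0 := by
    simp only [p, map_sum, Polynomial.aeval_monomial, map_sub, map_intCast]
    simp only [Finset.sum_range_succ, Finset.sum_range_zero] at h ⊢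
    linear_combination h - (c 4 : ℂ) * hz
  have hdeg : p.degree < 4 := by
    refine (Polynomial.degree_sum_le _ _).trans_lt ((Finset.sup_lt_iff (by decide)).mpr ?_)
    intro j hj
    refine (Polynomial.degree_monomial_le _ _).trans_lt ?_
    exact_mod_cast Finset.mem_range.mp hj
  have hmin : (minpoly ℚ ζ).degree = 4 := by
    rw [← Polynomial.cyclotomic_eq_minpoly_rat hζ (by norm_num), Polynomial.degree_cyclotomic]
    rfl
  have h0 : p = 0 := by
    by_contra hne
    have := minpoly.degree_le_of_ne_zero ℚ ζ hne hp
    rw [hmin] at this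
    exact absurd hdeg (not_lt.mpr this)
  rcases eq_or_ne i 4 with rfl | h4
  · rfl
  · have h5 := congrArg (fun q => Polynomial.coeff q i) h0
    simp only [p, Polynomial.finsetSum_coeff, Polynomial.coeff_monomial, Polynomial.coeff_zero,
      Finset.sum_ite_eq', Finset.mem_range, show i < 4 by omega, if_true] at h5
    exact_mod_cast sub_eq_zero.mp h5

theorem N_eq_N_emod (t : ℕ) (i : ℤ) (m n : ℕ) : N t i m n = N t (i % m) m n := by
  simp only [N, Int.ModEq, Int.emod_emod]

theorem N_eq_w_div_five {t n : ℕ} (ht : 0 < t) (h0 : n % 5 = 3 ∨ n % 5 = 4)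
    (h1 : ∀ i < 3, (i + t) % 5 ≠ n % 5) (i : ℤ) : (N t i 5 n : ℚ) = (w t n : ℚ) / 5 := by
  have hζ := Complex.isPrimitiveRoot_exp 5 (by norm_num)
  set ζ := Complex.exp (2 * Real.pi * Complex.I / (5 : ℕ))
  have hz : 1 + ζ + ζ ^ 2 + ζ ^ 3 + ζ ^ 4 = 0 := by
    have := hζ.geom_sum_eq_zero (by norm_num)
    simpa [Finset.sum_range_succ] using this
  have hsum := coeff_sizeGenFun_vectorPartition_eq_zero ht hz h0 h1
  rw [coeff_sizeGenFun_vectorPartition ht hζ.pow_eq_one] at hsum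
  have heq := eq_of_sum_mul_primitiveRoot_eq_zero hζ (fun i => N t i 5 n) hsum
  have hw := sum_N_eq_w ht n
  rw [Finset.sum_congr rfl fun j hj => heq j (Finset.mem_range.mp hj)] at hw
  obtain ⟨j, hj⟩ := Int.eq_ofNat_of_zero_le (Int.emod_nonneg i (show (5 : ℤ) ≠ 0 by norm_num))
  have hj5 : j < 5 := by omega
  have hN : N t i 5 n = N t (4 : ℕ) 5 n := by
    rw [N_eq_N_emod, ← heq j hj5]
    exact congrArg (fun k => N t k 5 n) hj
  rw [hN, ← hw]
  simp

end WeightedPartition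

open WeightedPartition in
theorem mainTheorem7 (t n : ℕ) (ht : 0 < t) :
    (t ≡ 1 [MOD 5] → ∀ i : ℤ, (N t i 5 (5 * n + 4) : ℚ) = (w t (5 * n + 4) : ℚ) / 5) ∧
    (t ≡ 4 [MOD 5] → ∀ i : ℤ, (N t i 5 (5 * n + 3) : ℚ) = (w t (5 * n + 3) : ℚ) / 5) ∧
    (t ≡ 0 [MOD 5] → ∀ i : ℤ, (N t i 5 (5 * n + 3) : ℚ) = (w t (5 * n + 3) : ℚ) / 5) ∧
    (t ≡ 0 [MOD 5] → ∀ i : ℤ, (N t i 5 (5 * n + 4) : ℚ) = (w t (5 * n + 4) : ℚ) / 5) := by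
  -- The classes `{0,1,2} + {0,t}` miss 4 if `t ≡ 1`, 3 if `t ≡ 4`, and both if `t ≡ 0`.
  refine ⟨fun h => ?_, fun h => ?_, fun h => ?_, fun h => ?_⟩ <;>
    exact N_eq_w_div_five ht (by omega) (by rw [Nat.ModEq] at h; omega)
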